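/- Let $n,m,r\ge 1$. Equip $\mathbb{R}^{n\times r}\times\mathbb{R}^{m\times r}\cong\mathbb{R}^{(n+m)r}$ and $\mathbb{R}^{n\times m}\cong\mathbb{R}^{nm}$ with their Euclidean inner products, and let $\phi_{\mathtt{Lin}}(U,V)=UV^\top$. For a smooth map $\phi:\mathbb{R}^D\to\mathbb{R}^d$, put $M(\theta)=\partial\phi(\theta)\,\partial\phi(\theta)^\top\in\mathbb{R}^{d\times d}$. A conservation law for $\phi$ on an open set $W\subseteq\mathbb{R}^D$ is a function $h\in\mathcal{C}^1(W,\mathbb{R})$ with $\partial\phi(\theta)\nabla h(\theta)=0$ for all $\theta\in W$. A point $\theta_0$ satisfies the intrinsic metric property on an open set $W\ni\theta_0$ with respect to $\phi$ if there exist $N\ge 0$, conservation laws $h_1,\dots,h_N$ for $\phi$ on $W$, and a function $K\in\mathcal{C}^1(\mathbb{R}^d,\mathbb{R}^{d\times d})$ such that $M(\theta)=K(\phi(\theta))$ for every $\theta\in W$ with $h_i(\theta)=h_i(\theta_0)$ for $i=1,\dots,N$. **Theorem.** Let $\theta_0=(U_0,V_0)$, where $U_0\in\mathbb{R}^{n\times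 r}$ and $V_0\in\mathbb{R}^{m\times r}$ both have full rank (that is, $\operatorname{rank}U_0=\min(n,r)$ and $\operatorname{rank}V_0=\min(m,r)$), and assume $r\le\max(n,m)$. If $S:=U_0^\top U_0-V_0^\top V_0$ is not of the form $\lambda I_r$ with $\lambda\in\mathbb{R}$, then there is no open set $W\ni\theta_0$ on which $\theta_0$ satisfies the intrinsic metric property with respect to $\phi_{\mathtt{Lin}}$. -/

import Mathlib

namespace IntrinsicMetric

noncomputable section

section General

variable {E F : Type*}
  [NormedAddCommGroup E] [InnerProductSpace ℝ E] [FiniteDimensional ℝ E]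
  [NormedAddCommGroup F] [InnerProductSpace ℝ F] [FiniteDimensional ℝ F]

/-- `M(θ) = ∂φ(θ) ∂φ(θ)ᵀ`, as an endomorphism of the Euclidean space in which `φ` takes values
(the transpose is the adjoint for the Euclidean inner products). -/
def metricOp (φ : E → F) (θ : E) : F →L[ℝ] F :=
  haveI := FiniteDimensional.complete ℝ E
  haveI := FiniteDimensional.complete ℝ F
  (fderiv ℝ φ θ) ∘L (ContinuousLinearMap.adjoint (fderiv ℝ φ θ))

/-- `h` is a conservation law for `φ` on the (open) set `Ω`: it is `C¹` on `Ω` and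
`∂φ(θ) ∇h(θ) = 0` for all `θ ∈ Ω`. -/
def IsConservationLaw (φ : E → F) (Ω : Set E) (h : E → ℝ) : Prop :=
  haveI := FiniteDimensional.complete ℝ E
  ContDiffOn ℝ 1 h Ω ∧ ∀ θ ∈ Ω, fderiv ℝ φ θ (gradient h θ) = 0

/-- The level set of `h = (h₁, …, h_N)` through `θ₀`. -/
def levelSet {N : ℕ} (h : Fin N → E → ℝ) (θ₀ : E) : Set E :=
  {θ | ∀ i, h i θ = h i θ₀}

/-- `θ₀` verifies the intrinsic metric property with respect to `φ` on the open set `W ∋ θ₀`.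
Only the behaviour of the conservation laws on `W` matters. -/
def IntrinsicMetricPropertyOn (φ : E → F) (θ₀ : E) (W : Set E) : Prop :=
  IsOpen W ∧ θ₀ ∈ W ∧
    ∃ (N : ℕ) (h : Fin N → E → ℝ) (K : F → (F →L[ℝ] F)),
      (∀ i, IsConservationLaw φ W (h i)) ∧
      ContDiff ℝ 1 K ∧
      ∀ θ ∈ levelSet h θ₀ ∩ W, metricOp φ θ = K (φ θ)

/-- `θ₀` verifies the intrinsic metric property with respect to `φ`, on some open set around it. -/
def IntrinsicMetricProperty (φ : E → F) (θ₀ : E) : Prop :=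
  ∃ W : Set E, IntrinsicMetricPropertyOn φ θ₀ W

end General

section Linear

/-- The parameter space `ℝ^{n×r} × ℝ^{m×r} = ℝ^D`, `D = (n+m)r`, with its Euclidean structure. -/
abbrev Param (n m r : ℕ) : Type :=
  EuclideanSpace ℝ ((Fin n × Fin r) ⊕ (Fin m × Fin r))

/-- The parameter `θ = (U, V)`. -/
def toParam {n m r : ℕ} (U : Matrix (Fin n) (Fin r) ℝ) (V : Matrix (Fin m) (Fin r) ℝ) :
    Param n m r :=
  WithLp.toLp 2 (Sum.elim (fun p => U p.1 p.2) (fun p => V p.1 p.2))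

/-- The block `U` of `θ = (U, V)`. -/
def matU {n m r : ℕ} (θ : Param n m r) : Matrix (Fin n) (Fin r) ℝ :=
  Matrix.of fun i k => θ (Sum.inl (i, k))

/-- The block `V` of `θ = (U, V)`. -/
def matV {n m r : ℕ} (θ : Param n m r) : Matrix (Fin m) (Fin r) ℝ :=
  Matrix.of fun j k => θ (Sum.inr (j, k))

/-- `φ_Lin(U, V) = U Vᵀ`, in `ℝ^{n×m}` with its Euclidean (Frobenius) structure. -/
def phiLin (n m r : ℕ) (θ : Param n m r) : EuclideanSpace ℝ (Fin n × Fin m) :=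
  WithLp.toLp 2 (fun p => (matU θ * (matV θ).transpose) p.1 p.2)

end Linear

end

end IntrinsicMetric

open scoped Matrix Topology

namespace IntrinsicMetric

/-! The gradient of a conservation law `h` is orthogonal to the range of `∂φᵀ`, so `h` is
annihilated by the linear fields `(ZV, ZᵀU)`. Their brackets produce `(aU, 0)` and `(0, bV)` with
`a`, `b` skew, hence all of `so(n, m)` (`fderiv_apply_blockAction`). Flowing `θ₀` along such a field
therefore stays in the level set, where `M = K ∘ φ`. If its velocity `η` at `θ₀` lies in `ker ∂φ`,
the derivative of `M` along `η` must vanish (`metric_derivative_eq_zero`).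

Take `η = (UX, -VXᵀ)`, which lies in `ker ∂φ`. With `A = UᵀU` and `B = VᵀV`, it is an `so(n, m)`
motion as soon as `AX + XB` is skew (`exists_so_motion`). The derivative of `M` then reads `Y ↦ DY +
YF` with `D = U(X + Xᵀ)Uᵀ` and `F = -V(X + Xᵀ)Vᵀ`. If it vanishes, `D` and `F` are opposite scalars;
equality of their traces makes both zero, and a left inverse of `U` or `V` gives `X + Xᵀ = 0`. When
`A - B` is not scalar, a suitable non-skew `X` exists (`exists_not_skew`), a contradiction. -/

/-! ### Matrix algebra: Sylvester equation, skew-symmetric matrices, choice of the motion. -/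

lemma exists_left_inverse_of_rank_eq {n r : ℕ} {U : Matrix (Fin n) (Fin r) ℝ}
    (hU : U.rank = r) : ∃ L : Matrix (Fin r) (Fin n) ℝ, L * U = 1 := by
  have hunit : IsUnit (Uᵀ * U) := by
    rw [← Matrix.mulVec_injective_iff_isUnit, Matrix.mulVec_injective_iff,
      linearIndependent_iff_card_eq_finrank_span, Set.finrank,
      ← Matrix.rank_eq_finrank_span_cols, Matrix.rank_transpose_mul_self, hU, Fintype.card_fin]
  refine ⟨(Uᵀ * U)⁻¹ * Uᵀ, ?_⟩
  rw [Matrix.mul_assoc, Matrix.nonsing_inv_mul _ ((Matrix.isUnit_iff_isUnit_det _).1 hunit)]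

lemma trace_transpose_mul_self_nonneg {p q : ℕ} (Y : Matrix (Fin p) (Fin q) ℝ) :
    0 ≤ (Yᵀ * Y).trace := by
  simp only [Matrix.trace, Matrix.diag_apply, Matrix.mul_apply, Matrix.transpose_apply]
  exact Finset.sum_nonneg fun i _ => Finset.sum_nonneg fun j _ => mul_self_nonneg _

lemma eq_zero_of_trace_transpose_mul_self {p q : ℕ} {Y : Matrix (Fin p) (Fin q) ℝ}
    (h : (Yᵀ * Y).trace = 0) : Y = 0 := by
  rw [← Matrix.conjTranspose_eq_transpose_of_trivial] at h
  exact Matrix.trace_conjTranspose_mul_self_eq_zero_iff.1 h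

/-- The Sylvester map `X ↦ AX + XB` of two Gram matrices, one of which is definite, is onto. -/
lemma sylvester_surjective {n m r : ℕ} {U : Matrix (Fin n) (Fin r) ℝ}
    {V : Matrix (Fin m) (Fin r) ℝ}
    (hL : (∃ L : Matrix (Fin r) (Fin n) ℝ, L * U = 1) ∨
      ∃ L : Matrix (Fin r) (Fin m) ℝ, L * V = 1)
    (Y : Matrix (Fin r) (Fin r) ℝ) : ∃ X, Uᵀ * U * X + X * (Vᵀ * V) = Y := by
  let f : Matrix (Fin r) (Fin r) ℝ →ₗ[ℝ] Matrix (Fin r) (Fin r) ℝ :=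
    LinearMap.mulLeft ℝ (Uᵀ * U) + LinearMap.mulRight ℝ (Vᵀ * V)
  have hf : ∀ X, f X = Uᵀ * U * X + X * (Vᵀ * V) := fun X => rfl
  have hinj : Function.Injective f := by
    rw [injective_iff_map_eq_zero]
    intro X hX
    -- Pairing `AX + XB = 0` with `X` gives `‖UX‖² + ‖VXᵀ‖² = 0`; a left inverse of either factor
    -- then kills `X`.
    have ht : ((U * X)ᵀ * (U * X)).trace + ((V * Xᵀ)ᵀ * (V * Xᵀ)).trace = 0 := by
      have h2 : (Xᵀ * f X).trace = 0 := by rw [hX]; simp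
      rw [hf, Matrix.mul_add, Matrix.trace_add] at h2
      rw [← h2]
      congr 1
      · simp only [Matrix.transpose_mul, Matrix.mul_assoc]
      · rw [Matrix.trace_mul_comm Xᵀ]
        simp only [Matrix.transpose_mul, Matrix.mul_assoc, Matrix.transpose_transpose]
    have h1 := trace_transpose_mul_self_nonneg (U * X)
    have h2 := trace_transpose_mul_self_nonneg (V * Xᵀ)
    have hUX := eq_zero_of_trace_transpose_mul_self (Y := U * X) (by linarith)
    have hVX := eq_zero_of_trace_transpose_mul_self (Y := V * Xᵀ) (by linarith)
    rcases hL with ⟨L, hL⟩ | ⟨L, hL⟩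
    · rw [← Matrix.one_mul X, ← hL, Matrix.mul_assoc, hUX, Matrix.mul_zero]
    · rw [← Matrix.transpose_eq_zero, ← Matrix.one_mul Xᵀ, ← hL, Matrix.mul_assoc, hVX,
        Matrix.mul_zero]
  exact (LinearMap.injective_iff_surjective.1 hinj) Y

/-- A symmetric matrix commuting with all skew-symmetric matrices is scalar. -/
lemma exists_eq_smul_one_of_commute_skew {r : ℕ} {S : Matrix (Fin r) (Fin r) ℝ} (hS : Sᵀ = S)
    (hc : ∀ X : Matrix (Fin r) (Fin r) ℝ, Xᵀ = -X → S * X = X * S) :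
    ∃ c : ℝ, S = c • (1 : Matrix (Fin r) (Fin r) ℝ) := by
  have key : ∀ i j : Fin r, i ≠ j → S i j = 0 ∧ S i i = S j j := by
    intro i j hij
    -- Entry `(i, i)` gives `-S i j = S j i`, hence zero by symmetry; entry `(i, j)` equates the two
    -- diagonal entries.
    have h := hc (Matrix.single i j 1 - Matrix.single j i 1) (by simp)
    have h1 := congrFun (congrFun h i) i
    have h2 := congrFun (congrFun h i) j
    have h3 : S j i = S i j := congrFun (congrFun hS i) j
    simp [Matrix.mul_sub, Matrix.sub_mul, hij, hij.symm, Matrix.mul_single_apply_of_ne,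
      Matrix.single_mul_apply_of_ne] at h1 h2
    exact ⟨by linarith, h2⟩
  rcases isEmpty_or_nonempty (Fin r) with h | ⟨⟨k⟩⟩
  · exact ⟨0, Subsingleton.elim _ _⟩
  · refine ⟨S k k, ?_⟩
    ext i j
    by_cases hij : i = j
    · subst hij
      by_cases hik : i = k
      · simp [hik]
      · simp [(key i k hik).2]
    · simp [hij, (key i j hij).1]

/-- If `UᵀU - VᵀV` is not scalar, some `X` with `UᵀUX + XVᵀV` skew-symmetric is not itself
skew-symmetric. -/
lemma exists_not_skew {n m r : ℕ} {U : Matrix (Fin n) (Fin r) ℝ} {V : Matrix (Fin m) (Fin r) ℝ}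
    (hL : (∃ L : Matrix (Fin r) (Fin n) ℝ, L * U = 1) ∨
      ∃ L : Matrix (Fin r) (Fin m) ℝ, L * V = 1)
    (hS : ∀ c : ℝ, Uᵀ * U - Vᵀ * V ≠ c • (1 : Matrix (Fin r) (Fin r) ℝ)) :
    ∃ X : Matrix (Fin r) (Fin r) ℝ,
      Xᵀ * (Uᵀ * U) + Vᵀ * V * Xᵀ = -(Uᵀ * U * X + X * (Vᵀ * V)) ∧ X + Xᵀ ≠ 0 := by
  by_contra! hcon
  set A := Uᵀ * U with hA
  set B := Vᵀ * V with hB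
  have hAt : Aᵀ = A := by simp [hA]
  have hBt : Bᵀ = B := by simp [hB]
  let skew : Submodule ℝ (Matrix (Fin r) (Fin r) ℝ) :=
    LinearMap.ker (LinearMap.id + (Matrix.transposeLinearEquiv (Fin r) (Fin r) ℝ ℝ).toLinearMap)
  have hskew : ∀ X, X ∈ skew ↔ X + Xᵀ = 0 := fun X => by
    simp [skew, LinearMap.mem_ker]
  -- `g` inverts the Sylvester map. By `hcon` it preserves skew matrices; being injective there, it
  -- is bijective by finite dimension, so the Sylvester map itself preserves them.
  choose g hg using sylvester_surjective hL
  have hgs : ∀ N ∈ skew, g N ∈ skew := by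
    intro N hN
    rw [hskew] at hN ⊢
    apply hcon
    rw [hg N, ← add_eq_zero_iff_eq_neg, ← hN, add_comm]
    congr 1
    conv_rhs => rw [← hg N]
    simp [hA, hB]
  have hinj : ∀ X Y, A * X + X * B = A * Y + Y * B → X = Y := by
    let f : Matrix (Fin r) (Fin r) ℝ →ₗ[ℝ] Matrix (Fin r) (Fin r) ℝ :=
      LinearMap.mulLeft ℝ A + LinearMap.mulRight ℝ B
    have : Function.Surjective f := fun Y => ⟨g Y, hg Y⟩
    exact fun X Y h => LinearMap.injective_iff_surjective.2 this h
  let G : skew →ₗ[ℝ] skew :=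
    { toFun := fun N => ⟨g N, hgs N N.2⟩
      map_add' := fun N N' => Subtype.ext <| hinj _ _ <| by
        have h1 := hg (N + N' : Matrix (Fin r) (Fin r) ℝ)
        have h2 := hg N
        have h3 := hg N'
        simp only [Submodule.coe_add]
        rw [h1, Matrix.mul_add, Matrix.add_mul, add_add_add_comm, h2, h3]
      map_smul' := fun c N => Subtype.ext <| hinj _ _ <| by
        have h1 := hg (c • N : Matrix (Fin r) (Fin r) ℝ)
        have h2 := hg N
        simp only [Submodule.coe_smul, RingHom.id_apply]
        rw [h1, Matrix.mul_smul, Matrix.smul_mul, ← smul_add, h2] }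
  have hGinj : Function.Injective G := by
    intro N N' h
    have h' : g N = g N' := congrArg Subtype.val h
    apply Subtype.ext
    rw [← hg N, ← hg N', h']
  have hGsurj := LinearMap.injective_iff_surjective.1 hGinj
  obtain ⟨c, hc⟩ := exists_eq_smul_one_of_commute_skew (S := A - B) (by simp [hAt, hBt]) (by
    intro X hX
    obtain ⟨N, hN⟩ := hGsurj ⟨X, (hskew X).2 (by rw [hX, add_neg_cancel])⟩
    have hNX : A * X + X * B = N := by
      have : g N = X := congrArg Subtype.val hN
      rw [← this]; exact hg N
    -- For skew `X`, skewness of `AX + XB` is exactly `(A - B)X = X(A - B)`.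
    have hNt := (hskew _).1 N.2
    rw [← hNX] at hNt
    simp only [Matrix.transpose_add, Matrix.transpose_mul, hAt, hBt, hX] at hNt
    rw [← sub_eq_zero, ← hNt]
    noncomm_ring)
  exact hS c hc

/-- The vector `(UX, -VXᵀ)` is an infinitesimal `so(n, m)` motion of `(U, V)`. -/
lemma exists_so_motion {n m r : ℕ} {U : Matrix (Fin n) (Fin r) ℝ} {V : Matrix (Fin m) (Fin r) ℝ}
    (hL : (∃ L : Matrix (Fin r) (Fin n) ℝ, L * U = 1) ∨
      ∃ L : Matrix (Fin r) (Fin m) ℝ, L * V = 1)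
    {X : Matrix (Fin r) (Fin r) ℝ}
    (hX : Xᵀ * (Uᵀ * U) + Vᵀ * V * Xᵀ = -(Uᵀ * U * X + X * (Vᵀ * V))) :
    ∃ (a : Matrix (Fin n) (Fin n) ℝ) (Z : Matrix (Fin n) (Fin m) ℝ)
      (b : Matrix (Fin m) (Fin m) ℝ), aᵀ = -a ∧ bᵀ = -b ∧
      a * U + Z * V = U * X ∧ Zᵀ * U + b * V = -(V * Xᵀ) := by
  rcases hL with ⟨L, hL⟩ | ⟨L, hL⟩
  · set C := Xᵀ * (Uᵀ * U) + X * (Vᵀ * V) with hC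
    have hCt : Cᵀ = -C := by
      have : Cᵀ = (Uᵀ * U * X + X * (Vᵀ * V)) + (Vᵀ * V * Xᵀ) - X * (Vᵀ * V) := by
        simp only [hC, Matrix.transpose_add, Matrix.transpose_mul, Matrix.transpose_transpose]
        abel
      rw [this, ← neg_eq_iff_eq_neg.2 hX]
      rw [hC]
      abel
    -- With `b = 0`, this `Z` solves the second equation because `LU = 1`. The first becomes `aU =
    -- UX + LᵀXVᵀV`; the `C` term corrects the skew part of `UXL` to achieve this, and `a` stays
    -- skew since `C` is.
    refine ⟨U * X * L - (U * X * L)ᵀ + Lᵀ * C * L, -(Lᵀ * X * Vᵀ), 0, ?_, by simp, ?_, ?_⟩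
    · simp only [Matrix.transpose_add, Matrix.transpose_sub, Matrix.transpose_mul,
        Matrix.transpose_transpose, hCt, Matrix.mul_neg, Matrix.neg_mul, Matrix.mul_assoc]
      abel
    · simp only [Matrix.add_mul, Matrix.sub_mul, Matrix.mul_assoc, hL, Matrix.transpose_mul,
        Matrix.mul_one, Matrix.neg_mul, hC, Matrix.mul_add]
      abel
    · simp only [Matrix.transpose_neg, Matrix.transpose_mul, Matrix.transpose_transpose,
        Matrix.neg_mul, Matrix.mul_assoc, hL, Matrix.mul_one, Matrix.zero_mul, add_zero]
  · set C := X * (Vᵀ * V) + Xᵀ * (Uᵀ * U) with hC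
    have hCt : Cᵀ = -C := by
      have : Cᵀ = (Uᵀ * U * X + X * (Vᵀ * V)) + (Vᵀ * V * Xᵀ) - X * (Vᵀ * V) := by
        simp only [hC, Matrix.transpose_add, Matrix.transpose_mul, Matrix.transpose_transpose]
        abel
      rw [this, ← neg_eq_iff_eq_neg.2 hX]
      rw [hC]
      abel
    refine ⟨0, U * X * L, (V * Xᵀ * L)ᵀ - V * Xᵀ * L - Lᵀ * C * L, by simp, ?_, ?_, ?_⟩
    · simp only [Matrix.transpose_sub, Matrix.transpose_mul,
        Matrix.transpose_transpose, hCt, Matrix.mul_neg, Matrix.neg_mul, Matrix.mul_assoc]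
      abel
    · simp only [Matrix.mul_assoc, hL, Matrix.mul_one, Matrix.zero_mul, zero_add]
    · simp only [Matrix.sub_mul, Matrix.mul_assoc, hL, Matrix.transpose_mul,
        Matrix.transpose_transpose, Matrix.mul_one, hC, Matrix.mul_add]
      abel

/-- If `DZ + ZF = 0` for all `Z` and the traces of `D` and `F` agree, then `D` and `F` vanish. -/
lemma eq_zero_of_mul_add_mul {n m : ℕ} (hn : 0 < n) (hm : 0 < m)
    {D : Matrix (Fin n) (Fin n) ℝ} {F : Matrix (Fin m) (Fin m) ℝ}
    (h : ∀ Z : Matrix (Fin n) (Fin m) ℝ, Z * F + D * Z = 0) (ht : D.trace = F.trace) :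
    D = 0 ∧ F = 0 := by
  have h1 : ∀ i j, D i i + F j j = 0 := fun i j => by
    have := congrFun (congrFun (h (Matrix.single i j 1)) i) j
    simp at this
    linarith
  have h2 : ∀ i k, k ≠ i → D k i = 0 := fun i k hk => by
    have := congrFun (congrFun (h (Matrix.single i ⟨0, hm⟩ 1)) k) ⟨0, hm⟩
    simpa [Matrix.single_mul_apply_of_ne, hk] using this
  have h3 : ∀ j l, l ≠ j → F j l = 0 := fun j l hl => by
    have := congrFun (congrFun (h (Matrix.single ⟨0, hn⟩ j 1)) ⟨0, hn⟩) l
    simpa [Matrix.mul_single_apply_of_ne, hl] using this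
  set c := D ⟨0, hn⟩ ⟨0, hn⟩ with hc
  have hF : ∀ j, F j j = -c := fun j => by linarith [h1 ⟨0, hn⟩ j]
  have hD : ∀ i, D i i = c := fun i => by linarith [h1 i ⟨0, hm⟩, hF ⟨0, hm⟩]
  -- Now `D = c • 1` and `F = -c • 1`, so equal traces mean `n c = -m c`.
  have hc0 : c = 0 := by
    simp only [Matrix.trace, Matrix.diag_apply, hD, hF, Finset.sum_const, Finset.card_univ,
      Fintype.card_fin, nsmul_eq_mul] at ht
    have hn' : (0 : ℝ) < n := by exact_mod_cast hn
    have hm' : (0 : ℝ) < m := by exact_mod_cast hm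
    have : ((n : ℝ) + m) * c = 0 := by linarith
    rcases mul_eq_zero.1 this with h | h
    · linarith
    · exact h
  constructor
  · ext i k
    by_cases hik : i = k
    · subst hik; simp [hD, hc0]
    · simp [h2 k i hik]
  · ext j l
    by_cases hjl : l = j
    · subst hjl; simp [hF, hc0]
    · simp [h3 j l hjl]

/-! ### Linear flows and functions invariant under them. -/

section Flow

variable {E : Type*} [NormedAddCommGroup E] [NormedSpace ℝ E]

/-- The linear flow `exp (s • T)`. -/
noncomputable def flow (T : E →L[ℝ] E) (s : ℝ) : E →L[ℝ] E :=
  NormedSpace.exp (s • T)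

lemma flow_zero (T : E →L[ℝ] E) : flow T 0 = 1 := by
  simp [flow]

variable [CompleteSpace E]

lemma hasDerivAt_flow (T : E →L[ℝ] E) (s : ℝ) : HasDerivAt (flow T) (T * flow T s) s :=
  hasDerivAt_exp_smul_const' T s

lemma hasDerivAt_flow_apply (T : E →L[ℝ] E) (x : E) (s : ℝ) :
    HasDerivAt (fun t => flow T t x) (T (flow T s x)) s := by
  simpa using (hasDerivAt_flow T s).clm_apply (hasDerivAt_const s x)

lemma continuous_flow (T : E →L[ℝ] E) : Continuous (flow T) :=
  continuous_iff_continuousAt.2 fun s => (hasDerivAt_flow T s).continuousAt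

/-- A function annihilated by the linear vector field `T` is locally invariant under its flow. -/
lemma eventually_comp_flow_eq {W : Set E} (hW : IsOpen W) {h : E → ℝ}
    (hd : DifferentiableOn ℝ h W) {T : E →L[ℝ] E} (hT : ∀ θ ∈ W, fderiv ℝ h θ (T θ) = 0)
    {θ : E} (hθ : θ ∈ W) :
    ∀ᶠ s in 𝓝 (0 : ℝ), ∀ᶠ η in 𝓝 θ, flow T s η ∈ W ∧ h (flow T s η) = h η := by
  have hc : Continuous fun p : ℝ × E => flow T p.1 p.2 :=
    ((continuous_flow T).comp continuous_fst).clm_apply continuous_snd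
  -- Joint continuity gives one time interval valid for all `η` near `θ`; this uniformity allows the
  -- invariance to be differentiated in `η`.
  have hmem : (fun p : ℝ × E => flow T p.1 p.2) ⁻¹' W ∈ 𝓝 ((0 : ℝ), θ) :=
    hc.continuousAt.preimage_mem_nhds (hW.mem_nhds (by simpa [flow_zero] using hθ))
  rw [nhds_prod_eq, Filter.mem_prod_iff] at hmem
  obtain ⟨I, hI, B, hB, hIB⟩ := hmem
  obtain ⟨ε, hε, hεI⟩ := Metric.mem_nhds_iff.1 hI
  filter_upwards [Metric.ball_mem_nhds (0 : ℝ) hε] with s hs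
  filter_upwards [hB] with η hη
  have hin : ∀ t ∈ Metric.ball (0 : ℝ) ε, flow T t η ∈ W := fun t ht =>
    hIB (Set.mk_mem_prod (hεI ht) hη)
  refine ⟨hin s hs, ?_⟩
  have hder : ∀ t ∈ Metric.ball (0 : ℝ) ε, HasDerivAt (fun t => h (flow T t η)) 0 t := by
    intro t ht
    have h1 := ((hd _ (hin t ht)).differentiableAt (hW.mem_nhds (hin t ht))).hasFDerivAt
    have h2 := h1.comp_hasDerivAt t (hasDerivAt_flow_apply T η t)
    rwa [hT _ (hin t ht)] at h2
  have := Metric.isOpen_ball.is_const_of_deriv_eq_zero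
    (convex_ball (0 : ℝ) ε).isPreconnected
    (fun t ht => (hder t ht).differentiableAt.differentiableWithinAt)
    (fun t ht => (hder t ht).deriv) hs (Metric.mem_ball_self hε)
  simpa [flow_zero] using this

/-- The linear vector fields annihilating a given function are stable under commutators. -/
lemma fderiv_commutator_eq_zero {W : Set E} (hW : IsOpen W) {h : E → ℝ}
    (hd : DifferentiableOn ℝ h W) {S T : E →L[ℝ] E} (hS : ∀ θ ∈ W, fderiv ℝ h θ (S θ) = 0)
    (hT : ∀ θ ∈ W, fderiv ℝ h θ (T θ) = 0) {θ : E} (hθ : θ ∈ W) :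
    fderiv ℝ h θ (S (T θ) - T (S θ)) = 0 := by
  -- Invariance under the flow of `S` transports `T`-annihilation at `flow S s θ` back to `θ`.
  -- Differentiating at `s = 0` yields the commutator using only first derivatives of `h`.
  have hev : (fun s => fderiv ℝ h θ (flow (-S) s (T (flow S s θ)))) =ᶠ[𝓝 (0 : ℝ)]
      fun _ => 0 := by
    filter_upwards [eventually_comp_flow_eq hW hd hS hθ] with s hs
    have hmem : flow S s θ ∈ W := hs.self_of_nhds.1
    have h1 : HasFDerivAt (fun η => h (flow S s η)) (fderiv ℝ h (flow S s θ) ∘L flow S s) θ :=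
      ((hd _ hmem).differentiableAt (hW.mem_nhds hmem)).hasFDerivAt.comp θ
        (flow S s).hasFDerivAt
    have h2 : fderiv ℝ h θ = fderiv ℝ h (flow S s θ) ∘L flow S s := by
      rw [← h1.fderiv]
      exact (Filter.EventuallyEq.fderiv_eq (hs.mono fun η hη => hη.2)).symm
    have h3 : flow S s * flow (-S) s = 1 := by
      let _ : NormedAlgebra ℚ (E →L[ℝ] E) := NormedAlgebra.restrictScalars ℚ ℝ _
      have : (s • S) + (s • -S) = 0 := by simp
      rw [flow, flow, ← NormedSpace.exp_add_of_commute, this, NormedSpace.exp_zero]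
      exact ((Commute.refl S).neg_right).smul_left s |>.smul_right s
    have h4 : ∀ x, flow S s (flow (-S) s x) = x := fun x => by
      simpa using congrArg (fun f : E →L[ℝ] E => f x) h3
    rw [h2, ContinuousLinearMap.comp_apply, h4]
    exact hT _ hmem
  have hder : HasDerivAt (fun s => fderiv ℝ h θ (flow (-S) s (T (flow S s θ))))
      (fderiv ℝ h θ (-S (T θ) + T (S θ))) 0 := by
    have h1 := T.hasFDerivAt.comp_hasDerivAt (0 : ℝ) (hasDerivAt_flow_apply S θ 0)
    have h2 := (hasDerivAt_flow (-S) 0).clm_apply h1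
    have h3 := (fderiv ℝ h θ).hasFDerivAt.comp_hasDerivAt (0 : ℝ) h2
    simpa [flow_zero, Function.comp_def] using h3
  have h0 := (hder.congr_of_eventuallyEq hev.symm).unique (hasDerivAt_const (0 : ℝ) (0 : ℝ))
  have : S (T θ) - T (S θ) = -(-S (T θ) + T (S θ)) := by abel
  rw [this, map_neg, h0, neg_zero]

end Flow

/-! ### Calculus of `φ_Lin`: differential, adjoint, metric and block actions. -/

section LinearNetwork

variable {n m r : ℕ}

@[simp] lemma matU_toParam (U : Matrix (Fin n) (Fin r) ℝ) (V : Matrix (Fin m) (Fin r) ℝ) :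
    matU (toParam U V) = U := rfl

@[simp] lemma matV_toParam (U : Matrix (Fin n) (Fin r) ℝ) (V : Matrix (Fin m) (Fin r) ℝ) :
    matV (toParam U V) = V := rfl

@[simp] lemma matU_add (θ η : Param n m r) : matU (θ + η) = matU θ + matU η := rfl

@[simp] lemma matV_add (θ η : Param n m r) : matV (θ + η) = matV θ + matV η := rfl

@[simp] lemma matU_smul (c : ℝ) (θ : Param n m r) : matU (c • θ) = c • matU θ := rfl

@[simp] lemma matV_smul (c : ℝ) (θ : Param n m r) : matV (c • θ) = c • matV θ := rfl

lemma toParam_add (U U' : Matrix (Fin n) (Fin r) ℝ) (V V' : Matrix (Fin m) (Fin r) ℝ) :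
    toParam (U + U') (V + V') = toParam U V + toParam U' V' := by
  ext p; rcases p with p | p <;> rfl

lemma toParam_sub (U U' : Matrix (Fin n) (Fin r) ℝ) (V V' : Matrix (Fin m) (Fin r) ℝ) :
    toParam (U - U') (V - V') = toParam U V - toParam U' V' := by
  ext p; rcases p with p | p <;> rfl

lemma toParam_smul (c : ℝ) (U : Matrix (Fin n) (Fin r) ℝ) (V : Matrix (Fin m) (Fin r) ℝ) :
    toParam (c • U) (c • V) = c • toParam U V := by
  ext p; rcases p with p | p <;> rfl

/-- The vector of entries of a matrix. -/
noncomputable def vec (Z : Matrix (Fin n) (Fin m) ℝ) : EuclideanSpace ℝ (Fin n × Fin m) :=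
  WithLp.toLp 2 fun p => Z p.1 p.2

lemma vec_add (Z Z' : Matrix (Fin n) (Fin m) ℝ) : vec (Z + Z') = vec Z + vec Z' := rfl

lemma vec_smul (c : ℝ) (Z : Matrix (Fin n) (Fin m) ℝ) : vec (c • Z) = c • vec Z := rfl

lemma vec_injective : Function.Injective (vec (n := n) (m := m)) := by
  intro Z Z' h
  ext i j
  exact congrArg (fun v : EuclideanSpace ℝ (Fin n × Fin m) => v (i, j)) h

/-- The bilinear map `((U, V), (U', V')) ↦ U V'ᵀ`. -/
noncomputable def prodBilin (n m r : ℕ) :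
    Param n m r →L[ℝ] Param n m r →L[ℝ] EuclideanSpace ℝ (Fin n × Fin m) :=
  LinearMap.toContinuousBilinearMap <|
    LinearMap.mk₂ ℝ (fun θ η => vec (matU θ * (matV η)ᵀ))
      (fun θ θ' η => by simp [Matrix.add_mul, vec_add])
      (fun c θ η => by simp [vec_smul])
      (fun θ η η' => by simp [Matrix.mul_add, vec_add])
      (fun c θ η => by simp [vec_smul])

lemma hasFDerivAt_phiLin (θ : Param n m r) :
    HasFDerivAt (phiLin n m r) (prodBilin n m r θ + (prodBilin n m r).flip θ) θ := by
  have h := (prodBilin n m r).hasFDerivAt_of_bilinear (hasFDerivAt_id θ) (hasFDerivAt_id θ)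
  convert! h using 1

lemma fderiv_phiLin_apply (θ η : Param n m r) :
    fderiv ℝ (phiLin n m r) θ η = vec (matU η * (matV θ)ᵀ + matU θ * (matV η)ᵀ) := by
  rw [(hasFDerivAt_phiLin θ).fderiv, vec_add, add_comm]
  rfl

lemma inner_toParam (U : Matrix (Fin n) (Fin r) ℝ) (V : Matrix (Fin m) (Fin r) ℝ)
    (θ : Param n m r) :
    inner ℝ (toParam U V) θ = (Uᵀ * matU θ).trace + (Vᵀ * matV θ).trace := by
  simp only [PiLp.inner_apply, Fintype.sum_sum_type, Fintype.sum_prod_type, Matrix.trace,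
    Matrix.diag_apply, Matrix.mul_apply, Matrix.transpose_apply]
  congr 1
  · rw [Finset.sum_comm]
    simp [toParam, matU, mul_comm]
  · rw [Finset.sum_comm]
    simp [toParam, matV, mul_comm]

lemma inner_vec (Z Y : Matrix (Fin n) (Fin m) ℝ) :
    inner ℝ (vec Z) (vec Y) = (Zᵀ * Y).trace := by
  simp only [PiLp.inner_apply, Fintype.sum_prod_type, Matrix.trace,
    Matrix.diag_apply, Matrix.mul_apply, Matrix.transpose_apply]
  rw [Finset.sum_comm]
  simp [vec, mul_comm]

lemma adjoint_fderiv_phiLin_vec (θ : Param n m r) (Z : Matrix (Fin n) (Fin m) ℝ) :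
    ContinuousLinearMap.adjoint (fderiv ℝ (phiLin n m r) θ) (vec Z) =
      toParam (Z * matV θ) (Zᵀ * matU θ) := by
  refine ext_inner_right ℝ fun η => ?_
  rw [ContinuousLinearMap.adjoint_inner_left, fderiv_phiLin_apply, inner_vec, inner_toParam,
    Matrix.mul_add, Matrix.trace_add]
  congr 1
  · rw [Matrix.transpose_mul, Matrix.mul_assoc, Matrix.trace_mul_comm (matV θ)ᵀ, Matrix.mul_assoc]
  · rw [← Matrix.trace_transpose]
    simp only [Matrix.transpose_mul, Matrix.transpose_transpose, Matrix.mul_assoc]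
    rw [Matrix.trace_mul_comm (matV η)]
    simp only [Matrix.mul_assoc]

lemma metricOp_phiLin_vec (θ : Param n m r) (Z : Matrix (Fin n) (Fin m) ℝ) :
    metricOp (phiLin n m r) θ (vec Z) =
      vec (Z * (matV θ * (matV θ)ᵀ) + matU θ * (matU θ)ᵀ * Z) := by
  rw [metricOp, ContinuousLinearMap.comp_apply, adjoint_fderiv_phiLin_vec, fderiv_phiLin_apply]
  simp [Matrix.mul_assoc]

/-- The linear vector field `(U, V) ↦ (aU + ZV, YU + bV)`. -/
noncomputable def blockAction (r : ℕ) (a : Matrix (Fin n) (Fin n) ℝ)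
    (Z : Matrix (Fin n) (Fin m) ℝ) (Y : Matrix (Fin m) (Fin n) ℝ) (b : Matrix (Fin m) (Fin m) ℝ) :
    Param n m r →L[ℝ] Param n m r :=
  LinearMap.toContinuousLinearMap
    { toFun := fun θ => toParam (a * matU θ + Z * matV θ) (Y * matU θ + b * matV θ)
      map_add' := fun θ η => by
        rw [← toParam_add]
        simp only [matU_add, matV_add, Matrix.mul_add]
        congr 1 <;> abel
      map_smul' := fun c θ => by
        rw [RingHom.id_apply, ← toParam_smul]
        simp }

lemma blockAction_apply (a : Matrix (Fin n) (Fin n) ℝ)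
    (Z : Matrix (Fin n) (Fin m) ℝ) (Y : Matrix (Fin m) (Fin n) ℝ) (b : Matrix (Fin m) (Fin m) ℝ)
    (θ : Param n m r) : blockAction r a Z Y b θ =
      toParam (a * matU θ + Z * matV θ) (Y * matU θ + b * matV θ) := rfl

/-- A skew-symmetric matrix is a combination of elementary skew-symmetric matrices. -/
lemma skew_eq_sum {p : ℕ} {a : Matrix (Fin p) (Fin p) ℝ} (ha : aᵀ = -a) :
    a = ∑ i, (1 / 2 : ℝ) • (Matrix.vecMulVec (a.col i) (Pi.single i 1) -
      Matrix.vecMulVec (Pi.single i 1) (a.col i)) := by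
  ext k l
  have h : a l k = -a k l := congrFun (congrFun ha k) l
  simp only [Matrix.sum_apply, Matrix.smul_apply, Matrix.sub_apply, Matrix.vecMulVec_apply,
    Matrix.col_apply, Pi.single_apply, smul_eq_mul]
  -- The sum collapses to `(a - aᵀ)/2`.
  simp [← Finset.mul_sum, Finset.sum_sub_distrib, h]
  ring

/-- A linear functional vanishing on the matrices `x yᵀ - y xᵀ` vanishes on all skew-symmetric
matrices. -/
lemma eq_zero_of_skew {p : ℕ} (f : Matrix (Fin p) (Fin p) ℝ →ₗ[ℝ] ℝ)
    (hf : ∀ x y, f (Matrix.vecMulVec x y - Matrix.vecMulVec y x) = 0)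
    {a : Matrix (Fin p) (Fin p) ℝ} (ha : aᵀ = -a) : f a = 0 := by
  rw [skew_eq_sum ha, map_sum]
  exact Finset.sum_eq_zero fun i _ => by rw [map_smul, hf, smul_zero]

/-! ### Invariance of conservation laws under `so(n, m)`. -/

section ConservationLaw

variable {W : Set (Param n m r)} {h : Param n m r → ℝ}

/-- The direction is `∂φᵀ` applied to `Z`, and `∇h` is orthogonal to the range of `∂φᵀ`. -/
lemma fderiv_apply_offDiag (hh : IsConservationLaw (phiLin n m r) W h)
    {θ : Param n m r} (hθ : θ ∈ W) (Z : Matrix (Fin n) (Fin m) ℝ) :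
    fderiv ℝ h θ (toParam (Z * matV θ) (Zᵀ * matU θ)) = 0 := by
  rw [← toDual_gradient, InnerProductSpace.toDual_apply_apply, ← adjoint_fderiv_phiLin_vec,
    ContinuousLinearMap.adjoint_inner_right, hh.2 θ hθ, inner_zero_left]

/-- Bracket of the off-diagonal fields with `Z = x eᵀ` and `Z = y eᵀ`, `e` a unit vector: the upper
block is `x yᵀ - y xᵀ`, and the lower one vanishes since `x ⬝ᵥ y` is symmetric. -/
lemma fderiv_apply_left_elementary (hW : IsOpen W) (hm : 0 < m)
    (hh : IsConservationLaw (phiLin n m r) W h) {θ : Param n m r} (hθ : θ ∈ W)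
    (x y : Fin n → ℝ) :
    fderiv ℝ h θ (toParam ((Matrix.vecMulVec x y - Matrix.vecMulVec y x) * matU θ) 0) = 0 := by
  let e : Fin m → ℝ := Pi.single ⟨0, hm⟩ 1
  have he : e ⬝ᵥ e = 1 := by simp [e]
  let T : (Fin n → ℝ) → Param n m r →L[ℝ] Param n m r := fun x =>
    blockAction r 0 (Matrix.vecMulVec x e) (Matrix.vecMulVec x e)ᵀ 0
  have hT : ∀ x, ∀ θ ∈ W, fderiv ℝ h θ (T x θ) = 0 := fun x θ hθ => by
    simpa [T, blockAction_apply] using fderiv_apply_offDiag hh hθ (Matrix.vecMulVec x e)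
  have hd := hh.1.differentiableOn (by simp)
  have key := fderiv_commutator_eq_zero hW hd (hT x) (hT y) hθ
  convert! key using 2
  simp only [T, blockAction_apply, matU_toParam, matV_toParam, ← toParam_sub, Matrix.zero_mul,
    zero_add, add_zero, Matrix.transpose_vecMulVec, ← Matrix.mul_assoc,
    Matrix.vecMulVec_mul_vecMulVec, he, one_smul, Matrix.sub_mul, dotProduct_comm y x, sub_self]

/-- Mirror image of the previous bracket, with `Z = e xᵀ` and `Z = e yᵀ`. -/
lemma fderiv_apply_right_elementary (hW : IsOpen W) (hn : 0 < n)
    (hh : IsConservationLaw (phiLin n m r) W h) {θ : Param n m r} (hθ : θ ∈ W)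
    (x y : Fin m → ℝ) :
    fderiv ℝ h θ (toParam 0 ((Matrix.vecMulVec x y - Matrix.vecMulVec y x) * matV θ)) = 0 := by
  let e : Fin n → ℝ := Pi.single ⟨0, hn⟩ 1
  have he : e ⬝ᵥ e = 1 := by simp [e]
  let T : (Fin m → ℝ) → Param n m r →L[ℝ] Param n m r := fun x =>
    blockAction r 0 (Matrix.vecMulVec e x) (Matrix.vecMulVec e x)ᵀ 0
  have hT : ∀ x, ∀ θ ∈ W, fderiv ℝ h θ (T x θ) = 0 := fun x θ hθ => by
    simpa [T, blockAction_apply] using fderiv_apply_offDiag hh hθ (Matrix.vecMulVec e x)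
  have hd := hh.1.differentiableOn (by simp)
  have key := fderiv_commutator_eq_zero hW hd (hT x) (hT y) hθ
  convert! key using 2
  simp only [T, blockAction_apply, matU_toParam, matV_toParam, ← toParam_sub, Matrix.zero_mul,
    zero_add, add_zero, Matrix.transpose_vecMulVec, ← Matrix.mul_assoc,
    Matrix.vecMulVec_mul_vecMulVec, he, one_smul, Matrix.sub_mul, dotProduct_comm y x, sub_self]

/-- Conservation laws are annihilated by the whole Lie algebra `so(n, m)`. -/
lemma fderiv_apply_blockAction (hW : IsOpen W) (hn : 0 < n) (hm : 0 < m)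
    (hh : IsConservationLaw (phiLin n m r) W h) {θ : Param n m r} (hθ : θ ∈ W)
    {a : Matrix (Fin n) (Fin n) ℝ} (ha : aᵀ = -a) (Z : Matrix (Fin n) (Fin m) ℝ)
    {b : Matrix (Fin m) (Fin m) ℝ} (hb : bᵀ = -b) :
    fderiv ℝ h θ (blockAction r a Z Zᵀ b θ) = 0 := by
  have hA : fderiv ℝ h θ (toParam (a * matU θ) 0) = 0 :=
    eq_zero_of_skew
      { toFun := fun a : Matrix (Fin n) (Fin n) ℝ => fderiv ℝ h θ (toParam (a * matU θ) 0)
        map_add' := fun a a' => by simp [← map_add, ← toParam_add, Matrix.add_mul]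
        map_smul' := fun c a => by
          rw [RingHom.id_apply, ← map_smul, ← toParam_smul, Matrix.smul_mul, smul_zero] }
      (fderiv_apply_left_elementary hW hm hh hθ) ha
  have hB : fderiv ℝ h θ (toParam 0 (b * matV θ)) = 0 :=
    eq_zero_of_skew
      { toFun := fun b : Matrix (Fin m) (Fin m) ℝ => fderiv ℝ h θ (toParam 0 (b * matV θ))
        map_add' := fun b b' => by simp [← map_add, ← toParam_add, Matrix.add_mul]
        map_smul' := fun c b => by
          rw [RingHom.id_apply, ← map_smul, ← toParam_smul, Matrix.smul_mul, smul_zero] }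
      (fderiv_apply_right_elementary hW hn hh hθ) hb
  have hZ := fderiv_apply_offDiag hh hθ Z
  have hsplit : blockAction r a Z Zᵀ b θ = toParam (a * matU θ) 0 +
      toParam (Z * matV θ) (Zᵀ * matU θ) + toParam 0 (b * matV θ) := by
    rw [blockAction_apply, ← toParam_add, ← toParam_add]
    simp
  rw [hsplit, map_add, map_add, hA, hB, hZ]
  simp

end ConservationLaw

/-- The bilinear form polarizing `θ ↦ Z V Vᵀ + U Uᵀ Z`. -/
noncomputable def metricBilin (r : ℕ) (Z : Matrix (Fin n) (Fin m) ℝ) :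
    Param n m r →L[ℝ] Param n m r →L[ℝ] EuclideanSpace ℝ (Fin n × Fin m) :=
  LinearMap.toContinuousBilinearMap <|
    LinearMap.mk₂ ℝ (fun θ η => vec (Z * (matV θ * (matV η)ᵀ) + matU θ * (matU η)ᵀ * Z))
      (fun θ θ' η => by
        rw [← vec_add]; congr 1
        simp only [matU_add, matV_add, Matrix.add_mul, Matrix.mul_add]; abel)
      (fun c θ η => by simp [← vec_smul])
      (fun θ η η' => by
        rw [← vec_add]; congr 1
        simp only [matU_add, matV_add, Matrix.add_mul, Matrix.mul_add, Matrix.transpose_add]; abel)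
      (fun c θ η => by simp [← vec_smul])

lemma metricBilin_apply (Z : Matrix (Fin n) (Fin m) ℝ) (θ η : Param n m r) :
    metricBilin r Z θ η = vec (Z * (matV θ * (matV η)ᵀ) + matU θ * (matU η)ᵀ * Z) := rfl

/-- Under the intrinsic metric property, the metric is infinitesimally constant along the
`so(n, m)` motions that fix the product `U Vᵀ` to first order. -/
lemma metric_derivative_eq_zero (hn : 0 < n) (hm : 0 < m) {θ₀ : Param n m r}
    (H : IntrinsicMetricProperty (phiLin n m r) θ₀)
    {a : Matrix (Fin n) (Fin n) ℝ} (ha : aᵀ = -a) (Z : Matrix (Fin n) (Fin m) ℝ)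
    {b : Matrix (Fin m) (Fin m) ℝ} (hb : bᵀ = -b) {η : Param n m r}
    (hη : blockAction r a Z Zᵀ b θ₀ = η) (hφ : fderiv ℝ (phiLin n m r) θ₀ η = 0)
    (Y : Matrix (Fin n) (Fin m) ℝ) :
    Y * (matV η * (matV θ₀)ᵀ + matV θ₀ * (matV η)ᵀ) +
      (matU η * (matU θ₀)ᵀ + matU θ₀ * (matU η)ᵀ) * Y = 0 := by
  obtain ⟨W, hW, hθ₀, N, h, K, hcons, hK, hM⟩ := H
  set T := blockAction r a Z Zᵀ b with hT
  have hinv : ∀ᶠ s in 𝓝 (0 : ℝ), ∀ i, flow T s θ₀ ∈ W ∧ h i (flow T s θ₀) = h i θ₀ := by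
    rw [Filter.eventually_all]
    intro i
    filter_upwards [eventually_comp_flow_eq hW ((hcons i).1.differentiableOn (by simp))
      (fun θ hθ => fderiv_apply_blockAction hW hn hm (hcons i) hθ ha Z hb) hθ₀] with s hs
    exact hs.self_of_nhds
  -- Needed separately because `hinv` is vacuous when `N = 0`.
  have hmem : ∀ᶠ s in 𝓝 (0 : ℝ), flow T s θ₀ ∈ W := by
    refine (hasDerivAt_flow_apply T θ₀ 0).continuousAt.preimage_mem_nhds (hW.mem_nhds ?_)
    simpa [flow_zero] using hθ₀
  have hγ : HasDerivAt (fun t => flow T t θ₀) η 0 := by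
    have := hasDerivAt_flow_apply T θ₀ 0
    rwa [flow_zero, one_apply_eq_self, hη] at this
  have hγ0 : flow T 0 θ₀ = θ₀ := by simp [flow_zero]
  -- Two expressions for `M` applied to `Y` along the flow: the quadratic one has the desired
  -- derivative, while the one through `K ∘ φ` has derivative zero because `η ∈ ker ∂φ`.
  have heq : (fun s => metricBilin r Y (flow T s θ₀) (flow T s θ₀)) =ᶠ[𝓝 (0 : ℝ)]
      fun s => K (phiLin n m r (flow T s θ₀)) (vec Y) := by
    filter_upwards [hinv, hmem] with s hs hsW
    rw [← hM _ ⟨fun i => (hs i).2, hsW⟩, metricOp_phiLin_vec, metricBilin_apply]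
  have hder1 : HasDerivAt (fun s => metricBilin r Y (flow T s θ₀) (flow T s θ₀))
      (metricBilin r Y η θ₀ + metricBilin r Y θ₀ η) 0 := by
    have h1 := ((metricBilin r Y).hasFDerivAt.comp_hasDerivAt (0 : ℝ) hγ).clm_apply hγ
    simpa [hγ0] using h1
  have hder2 : HasDerivAt (fun s => K (phiLin n m r (flow T s θ₀)) (vec Y)) 0 0 := by
    have h1 : HasDerivAt (fun s => phiLin n m r (flow T s θ₀)) 0 0 := by
      have h2 := (hasFDerivAt_phiLin (flow T 0 θ₀)).differentiableAt.hasFDerivAt.comp_hasDerivAt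
        (0 : ℝ) hγ
      rwa [hγ0, hφ] at h2
    have h3 := ((hK.differentiable (by simp)) (phiLin n m r (flow T 0 θ₀))).hasFDerivAt
      |>.comp_hasDerivAt (0 : ℝ) h1
    simpa using h3.clm_apply (hasDerivAt_const (0 : ℝ) (vec Y))
  have h0 := (hder1.congr_of_eventuallyEq heq.symm).unique hder2
  rw [metricBilin_apply, metricBilin_apply, ← vec_add] at h0
  have h1 := vec_injective (h0.trans (by rfl : (0 : EuclideanSpace ℝ (Fin n × Fin m)) = vec 0))
  rw [← h1]
  simp only [Matrix.mul_add, Matrix.add_mul]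
  abel

end LinearNetwork

end IntrinsicMetric

/-! ### The contradiction at `(U₀, V₀)`. -/

theorem mainTheorem3 (n m r : ℕ) (hn : 0 < n) (hm : 0 < m)
    (U₀ : Matrix (Fin n) (Fin r) ℝ) (V₀ : Matrix (Fin m) (Fin r) ℝ)
    (hU : U₀.rank = min n r) (hV : V₀.rank = min m r)
    (hr : r ≤ max n m)
    (hS : ∀ c : ℝ, U₀.transpose * U₀ - V₀.transpose * V₀ ≠ c • (1 : Matrix (Fin r) (Fin r) ℝ)) :
    ¬ IntrinsicMetric.IntrinsicMetricProperty (IntrinsicMetric.phiLin n m r)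
      (IntrinsicMetric.toParam U₀ V₀) := by
  intro H
  have hL : (∃ L : Matrix (Fin r) (Fin n) ℝ, L * U₀ = 1) ∨
      ∃ L : Matrix (Fin r) (Fin m) ℝ, L * V₀ = 1 := by
    -- Since `r ≤ max n m`, full rank gives independent columns to at least one factor.
    rcases le_max_iff.1 hr with h | h
    · exact Or.inl (IntrinsicMetric.exists_left_inverse_of_rank_eq (by rw [hU, min_eq_right h]))
    · exact Or.inr (IntrinsicMetric.exists_left_inverse_of_rank_eq (by rw [hV, min_eq_right h]))
  obtain ⟨X, hX, hX0⟩ := IntrinsicMetric.exists_not_skew hL hS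
  obtain ⟨a, Z, b, ha, hb, h1, h2⟩ := IntrinsicMetric.exists_so_motion hL hX
  have hder := IntrinsicMetric.metric_derivative_eq_zero hn hm H ha Z hb
    (η := IntrinsicMetric.toParam (U₀ * X) (-(V₀ * Xᵀ)))
    (by simp [IntrinsicMetric.blockAction_apply, h1, h2])
    (by
      rw [IntrinsicMetric.fderiv_phiLin_apply]
      simp only [IntrinsicMetric.matU_toParam, IntrinsicMetric.matV_toParam, Matrix.transpose_neg,
        Matrix.transpose_mul, Matrix.transpose_transpose, Matrix.mul_neg, Matrix.mul_assoc,
        add_neg_cancel]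
      rfl)
  -- By cyclicity this says that `U₀ᵀU₀X + XV₀ᵀV₀` has trace zero, which holds because it is skew.
  have htr : (U₀ * (X + Xᵀ) * U₀ᵀ).trace = (-(V₀ * (X + Xᵀ) * V₀ᵀ)).trace := by
    have h := congrArg Matrix.trace hX
    have e1 : (Xᵀ * (U₀ᵀ * U₀)).trace = (U₀ * Xᵀ * U₀ᵀ).trace := by
      rw [← Matrix.mul_assoc, Matrix.trace_mul_comm, Matrix.mul_assoc]
    have e2 : (V₀ᵀ * V₀ * Xᵀ).trace = (V₀ * Xᵀ * V₀ᵀ).trace := by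
      rw [Matrix.mul_assoc, Matrix.trace_mul_comm]
    have e3 : (U₀ᵀ * U₀ * X).trace = (U₀ * X * U₀ᵀ).trace := by
      rw [Matrix.mul_assoc, Matrix.trace_mul_comm]
    have e4 : (X * (V₀ᵀ * V₀)).trace = (V₀ * X * V₀ᵀ).trace := by
      rw [← Matrix.mul_assoc, Matrix.trace_mul_comm, Matrix.mul_assoc]
    simp only [Matrix.trace_add, Matrix.trace_neg, e1, e2, e3, e4] at h
    simp only [Matrix.mul_add, Matrix.add_mul, Matrix.trace_add, Matrix.trace_neg]
    linarith
  obtain ⟨hD, hF⟩ := IntrinsicMetric.eq_zero_of_mul_add_mul hn hm (fun Y => by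
    rw [← hder Y]
    simp only [IntrinsicMetric.matU_toParam, IntrinsicMetric.matV_toParam, Matrix.transpose_neg,
      Matrix.transpose_mul, Matrix.transpose_transpose, Matrix.mul_add, Matrix.add_mul,
      Matrix.mul_neg, Matrix.neg_mul, Matrix.mul_assoc]
    abel) htr
  apply hX0
  have hcancel : ∀ {p : ℕ} {L : Matrix (Fin r) (Fin p) ℝ} {Q : Matrix (Fin p) (Fin r) ℝ},
      L * Q = 1 → Q * (X + Xᵀ) * Qᵀ = 0 → X + Xᵀ = 0 := by
    intro p L Q hLQ hQ
    have hLt : Qᵀ * Lᵀ = 1 := by rw [← Matrix.transpose_mul, hLQ, Matrix.transpose_one]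
    calc X + Xᵀ = (L * Q) * (X + Xᵀ) * (Qᵀ * Lᵀ) := by rw [hLQ, hLt, Matrix.one_mul, Matrix.mul_one]
      _ = L * (Q * (X + Xᵀ) * Qᵀ) * Lᵀ := by simp only [Matrix.mul_assoc]
      _ = 0 := by rw [hQ, Matrix.mul_zero, Matrix.zero_mul]
  rcases hL with ⟨L, hL⟩ | ⟨L, hL⟩
  · exact hcancel hL hD
  · exact hcancel hL (neg_eq_zero.1 hF)
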